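/- \textbf{Setting.} Fix bounds $n$ and $\Delta$. A network is a graph of maximum degree at most $\Delta$ whose vertices carry distinct IDs from a set of $n$ IDs. Computation proceeds in synchronous rounds; in each round every vertex receives the current memory contents of its neighbors and then updates its own memory. Between two rounds the adversary may arbitrarily change the memory (RAM) of any vertices (faults), remove or add vertices and change links (dynamic updates), as long as the bounds $n,\Delta$ are respected. An adversarial change of memory is a fault at that vertex; a crash or appearance is an update at that vertex; the creation or removal of a link between two vertices that are both present before and after is an update at both endpoints. \textbf{Algorithm.} Let $\mathcal A$ be a deterministic distributed vertex-coloring algorithm. Along with $\mathcal A$, every vertex $v$ keeps a status in $\{\mathrm{MIS},\mathrm{NOTMIS},\mathrm{Undecided}\}$, and in every round, from the statuses and colors at the start of the round: if $v$ has status MIS and a neighbor in MIS, it becomes Undecided; if $v$ has status NOTMIS and no neighbor in MIS, it becomes Undecided; if $v$ is Undecided and has a neighbor in MIS, it becomes NOTMIS; if $v$ is Undecided (or has just become Undecided from NOTMIS in this very round), has no neighbor in MIS, and its color is smaller than the colors of all its Undecided neighbors, it joins MIS. A state is \emph{stabilized} if the coloring is proper and no color changes any more in the absence of faults, no vertex is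 Undecided, and the vertices of status MIS form a maximal independent set. \textbf{Adjustment radius.} This is the maximum (supremum in $\mathbb N\cup\{\infty\}$), over all executions starting in a stabilized state (with arbitrary faults and updates, in any number and at any times) and all initially present vertices $v$ whose status at some later time differs from the initial one, of the distance of $v$ from the closest fault or update that has occurred by then; the distance from a fault or update is taken in the network right before or right after it, whichever is smaller, and is $\infty$ if there was none. \textbf{Theorem.} (1) For every $\mathcal A$, the adjustment radius of the MIS algorithm is at most $2$: starting from a stabilized state, only vertices within distance $2$ of a fault or update can ever change their status. (2) This is tight: if $n\ge 3$, $\Delta\ge 2$ and $\mathcal A$ is self-stabilizing (that is, there are $k$ and $T$ such that in every network, from arbitrary memory contents, $T$ rounds without faults lead to a proper coloring with colors $0,\dots,k-1$ that no longer changes; in particular if $k=O(\Delta)$), then the adjustment radius equals $2$. (3) Moreover, a fault at distance $2$ can make a vertex join the MIS: in a stabilized state, let $v$ have status NOTMIS, let $u$ be its only neighbor in MIS, let $w\neq v$ be a neighbor of $u$ that is not adjacent to $v$, and suppose that the color of $v$ is smaller than that of $u$. If a fault changes the status of $w$ to MIS and no other fault or update occurs, then after two rounds $v$ has status MIS. 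-/

import Mathlib

namespace SelfStabMIS

/-- The communication network in one round. Vertices are named by their unique IDs in `Fin n`
(`n` is the known bound on the number of vertices); `alive` is the set of vertices that are
currently present, and `Δ` is the known bound on the maximum degree. -/
structure Network (n Δ : ℕ) where
  alive : Set (Fin n)
  graph : SimpleGraph (Fin n)
  alive_of_adj : ∀ {u v : Fin n}, graph.Adj u v → u ∈ alive
  degree_le : ∀ v : Fin n, (graph.neighborSet v).ncard ≤ Δ

/-- A deterministic synchronous distributed algorithm that maintains a vertex coloring, for given
bounds `n` and `Δ` (which it may use). `Mem` is the part of the RAM that it uses and `color` reads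
the current color off it. In each round a vertex computes its new memory by `next` from its ID, its
own memory and what it has received: `some` of the memory of `u` from every neighbor `u`, and `none`
from every vertex that is not a neighbor. -/
structure ColoringAlgorithm (n Δ : ℕ) where
  Mem : Type
  mem_nonempty : Nonempty Mem
  color : Mem → ℕ
  next : Fin n → Mem → (Fin n → Option Mem) → Mem

namespace ColoringAlgorithm

variable {n Δ : ℕ}

open Classical in
/-- One synchronous round, without faults, of a coloring algorithm in the network `N`. -/
noncomputable def round (A : ColoringAlgorithm n Δ) (N : Network n Δ) (m : Fin n → A.Mem) :
    Fin n → A.Mem :=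
  fun v => A.next v (m v) (fun u => if N.graph.Adj v u then some (m u) else none)

/-- The coloring is proper, and no color changes any more as long as nothing fails. -/
def ColoringStable (A : ColoringAlgorithm n Δ) (N : Network n Δ) (m : Fin n → A.Mem) : Prop :=
  (∀ u v, N.graph.Adj u v → A.color (m u) ≠ A.color (m v)) ∧
  ∀ v ∈ N.alive, ∀ t : ℕ, A.color ((A.round N)^[t] m v) = A.color (m v)

/-- `A` is a self-stabilizing vertex-coloring algorithm with `k` colors: from arbitrary memory
contents, in every network that respects the bounds, after some bounded number `T` of rounds without
faults the coloring is proper, uses only the colors `0, …, k - 1`, and does not change any more. -/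
def IsSelfStabilizing (A : ColoringAlgorithm n Δ) (k : ℕ) : Prop :=
  ∃ T : ℕ, ∀ (N : Network n Δ) (m : Fin n → A.Mem),
    A.ColoringStable N ((A.round N)^[T] m) ∧
    ∀ v ∈ N.alive, A.color ((A.round N)^[T] m v) < k

end ColoringAlgorithm

/-- The MIS status of a vertex. -/
inductive Status where
  | mis
  | notMis
  | undecided

/-- The RAM of a vertex in the MIS algorithm run on top of the coloring algorithm `A`. -/
structure Ram {n Δ : ℕ} (A : ColoringAlgorithm n Δ) where
  mem : A.Mem
  status : Status

section Algorithm

variable {n Δ : ℕ} {A : ColoringAlgorithm n Δ}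

/-- Vertex `v` has a neighbor in the MIS. -/
def HasMisNeighbor (N : Network n Δ) (σ : Fin n → Ram A) (v : Fin n) : Prop :=
  ∃ u, N.graph.Adj v u ∧ (σ u).status = Status.mis

/-- The color of `v` is smaller than that of all its undecided neighbors. -/
def ColorMinimal (N : Network n Δ) (σ : Fin n → Ram A) (v : Fin n) : Prop :=
  ∀ u, N.graph.Adj v u → (σ u).status = Status.undecided →
    A.color (σ v).mem < A.color (σ u).mem

open Classical in
/-- The status that `v` computes in a round. A vertex of the MIS with a neighbor in the MIS becomes
undecided. A `notMis` vertex without neighbor in the MIS becomes undecided. An undecided vertex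
with a neighbor in the MIS becomes `notMis`; an undecided vertex (or one that becomes so from
`notMis` in this very round) without neighbor in the MIS, whose color is smaller than
that of all its undecided neighbors, joins the MIS. -/
noncomputable def nextStatus (N : Network n Δ) (σ : Fin n → Ram A) (v : Fin n) : Status :=
  match (σ v).status with
  | Status.mis =>
      if HasMisNeighbor N σ v then Status.undecided else Status.mis
  | Status.notMis =>
      if HasMisNeighbor N σ v then Status.notMis
      else if ColorMinimal N σ v then Status.mis else Status.undecided
  | Status.undecided =>
      if HasMisNeighbor N σ v then Status.notMis
      else if ColorMinimal N σ v then Status.mis else Status.undecided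

/-- One synchronous round, without faults, of the MIS algorithm: every vertex performs a step of the
coloring algorithm and a step of the status rule, both from the states at the start of the round. -/
noncomputable def misRound (N : Network n Δ) (σ : Fin n → Ram A) : Fin n → Ram A :=
  fun v => ⟨A.round N (fun u => (σ u).mem) v, nextStatus N σ v⟩

/-- The algorithm has stabilized in `N`: the coloring is stable, no vertex is undecided, and
the vertices of status `mis` form a maximal independent set of the network. -/
structure Stabilized (N : Network n Δ) (σ : Fin n → Ram A) : Prop where
  coloring : A.ColoringStable N (fun u => (σ u).mem)
  decided : ∀ v ∈ N.alive, (σ v).status ≠ Status.undecided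
  independent : ∀ u v, N.graph.Adj u v →
    ¬((σ u).status = Status.mis ∧ (σ v).status = Status.mis)
  maximal : ∀ v ∈ N.alive, (σ v).status ≠ Status.mis → HasMisNeighbor N σ v

/-- Vertex `x` experiences a fault or a dynamic update when network and memory contents change
from `(N, σ)` to `(N', σ')` between two rounds: `x` crashes or appears, or the RAM of `x` is altered,
or a link between `x` and another vertex that is present before and after is created or removed.
(The crash or appearance of a vertex is an update of that vertex only.) -/
def Touched (N : Network n Δ) (σ : Fin n → Ram A) (N' : Network n Δ) (σ' : Fin n → Ram A)
    (x : Fin n) : Prop :=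
  (x ∈ N.alive ∧ x ∉ N'.alive) ∨ (x ∉ N.alive ∧ x ∈ N'.alive) ∨
  (x ∈ N.alive ∧ x ∈ N'.alive ∧
    (σ x ≠ σ' x ∨
      ∃ u, u ∈ N.alive ∧ u ∈ N'.alive ∧ ¬(N.graph.Adj x u ↔ N'.graph.Adj x u)))

end Algorithm

/-- An execution in the fully dynamic setting with faults: `net t` and `ram t` are the network and
the memory contents at the start of round `t`. Between the end of round `t` and the start of round
`t + 1` the network and the memory contents may change arbitrarily. -/
structure Execution {n Δ : ℕ} (A : ColoringAlgorithm n Δ) where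
  net : ℕ → Network n Δ
  ram : ℕ → Fin n → Ram A

namespace Execution

variable {n Δ : ℕ} {A : ColoringAlgorithm n Δ}

/-- `x` experiences a fault or a dynamic update between round `t` and round `t + 1`. -/
def TouchedAt (E : Execution A) (t : ℕ) (x : Fin n) : Prop :=
  Touched (E.net t) (misRound (E.net t) (E.ram t)) (E.net (t + 1)) (E.ram (t + 1)) x

/-- The distance of `v` from the closest fault or dynamic update that occurs before round `t`
(`⊤` if there is none), where distances from a fault or update are taken in the
network right before or right after it, whichever is smaller. -/
noncomputable def distToFaults (E : Execution A) (t : ℕ) (v : Fin n) : ℕ∞ :=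
  ⨅ (s : ℕ) (_ : s < t) (x : Fin n) (_ : E.TouchedAt s x),
    min ((E.net s).graph.edist v x) ((E.net (s + 1)).graph.edist v x)

end Execution

/-- The adjustment radius of the MIS algorithm run on top of `A`: the maximum, over all executions
that start in a stabilized state and all vertices whose status at some later time differs
from the initial one, of the distance of the vertex from the closest fault or dynamic update that
has occurred by that time. -/
noncomputable def adjustmentRadius {n Δ : ℕ} (A : ColoringAlgorithm n Δ) : ℕ∞ :=
  sSup {d : ℕ∞ | ∃ (E : Execution A) (t : ℕ) (v : Fin n),
    Stabilized (E.net 0) (E.ram 0) ∧ v ∈ (E.net 0).alive ∧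
    (E.ram t v).status ≠ (E.ram 0 v).status ∧ d = E.distToFaults t v}

end SelfStabMIS

/-!
In a stabilized state every present vertex is within distance one of a *settled* vertex: a vertex
of the MIS all of whose neighbors have status `notMis`. A settled vertex and its neighbors keep each
other's statuses whatever the colors do, so only a fault or an update in the closed neighborhood of
`u` can unsettle `u`, and every such fault lies within distance two of the vertices that `u`
settles. This gives the upper bound.

Conversely, suppose that `u` is the only neighbor of `v` in the MIS and that a fault puts another
neighbor `w` of `u` into the MIS. Then every neighbor of `v` has a neighbor in the MIS, so that none
of them is in the MIS one round later, and `v` gives up its status `notMis` in the round after that.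
On a path `v`, `u`, `w` the fault is at distance two from `v`.
-/

namespace SelfStabMIS

variable {n Δ : ℕ} {A : ColoringAlgorithm n Δ}

theorem Network.alive_of_adj_right (N : Network n Δ) {u v : Fin n} (h : N.graph.Adj u v) :
    v ∈ N.alive :=
  N.alive_of_adj h.symm

theorem ColoringAlgorithm.IsSelfStabilizing.exists_coloringStable {k : ℕ}
    (hA : A.IsSelfStabilizing k) (N : Network n Δ) : ∃ m, A.ColoringStable N m := by
  obtain ⟨T, hT⟩ := hA
  obtain ⟨m₀⟩ := A.mem_nonempty
  exact ⟨_, (hT N fun _ => m₀).1⟩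

theorem Status.eq_notMis_iff {s : Status} : s = notMis ↔ s ≠ mis ∧ s ≠ undecided := by
  cases s <;> simp

section Round

variable {N : Network n Δ} {σ : Fin n → Ram A} {v : Fin n}

theorem nextStatus_eq_mis_iff :
    nextStatus N σ v = .mis ↔
      ¬ HasMisNeighbor N σ v ∧ ((σ v).status = .mis ∨ ColorMinimal N σ v) := by
  unfold nextStatus
  cases (σ v).status <;> by_cases HasMisNeighbor N σ v <;> by_cases ColorMinimal N σ v <;> simp [*]

theorem nextStatus_eq_notMis_iff :
    nextStatus N σ v = .notMis ↔ (σ v).status ≠ .mis ∧ HasMisNeighbor N σ v := by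
  unfold nextStatus
  cases (σ v).status <;> by_cases HasMisNeighbor N σ v <;> by_cases ColorMinimal N σ v <;> simp [*]

@[simp]
theorem status_misRound : (misRound N σ v).status = nextStatus N σ v := rfl

theorem mem_misRound : (misRound N σ v).mem = A.round N (fun u => (σ u).mem) v := rfl

theorem not_hasMisNeighbor_misRound (h : ∀ x, N.graph.Adj v x → HasMisNeighbor N σ x) :
    ¬ HasMisNeighbor N (misRound N σ) v := by
  rintro ⟨x, hvx, hx⟩
  exact (nextStatus_eq_mis_iff.1 hx).1 (h x hvx)

end Round

namespace Stabilized

variable {N : Network n Δ} {σ : Fin n → Ram A} {v : Fin n}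

theorem not_hasMisNeighbor (h : Stabilized N σ) (hv : (σ v).status = .mis) :
    ¬ HasMisNeighbor N σ v :=
  fun ⟨u, hvu, hu⟩ => h.independent v u hvu ⟨hv, hu⟩

theorem status_eq_notMis (h : Stabilized N σ) (hv : v ∈ N.alive) (hm : (σ v).status ≠ .mis) :
    (σ v).status = .notMis :=
  Status.eq_notMis_iff.2 ⟨hm, h.decided v hv⟩

theorem nextStatus_eq (h : Stabilized N σ) (hv : v ∈ N.alive) :
    nextStatus N σ v = (σ v).status := by
  by_cases hm : (σ v).status = .mis
  · rw [hm, nextStatus_eq_mis_iff]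
    exact ⟨h.not_hasMisNeighbor hm, .inl hm⟩
  · rw [h.status_eq_notMis hv hm, nextStatus_eq_notMis_iff]
    exact ⟨hm, h.maximal v hv hm⟩

theorem color_round (h : Stabilized N σ) (hv : v ∈ N.alive) :
    A.color (A.round N (fun u => (σ u).mem) v) = A.color (σ v).mem :=
  h.coloring.2 v hv 1

theorem misRound (h : Stabilized N σ) : Stabilized N (misRound N σ) where
  coloring := by
    refine ⟨fun u v huv => ?_, fun v hv t => ?_⟩
    · simp only [mem_misRound, h.color_round (N.alive_of_adj huv),
        h.color_round (N.alive_of_adj_right huv)]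
      exact h.coloring.1 u v huv
    · exact (h.coloring.2 v hv (t + 1)).trans (h.color_round hv).symm
  decided v hv := by
    rw [status_misRound, h.nextStatus_eq hv]
    exact h.decided v hv
  independent u v huv := by
    rw [status_misRound, status_misRound, h.nextStatus_eq (N.alive_of_adj huv),
      h.nextStatus_eq (N.alive_of_adj_right huv)]
    exact h.independent u v huv
  maximal v hv hm := by
    rw [status_misRound, h.nextStatus_eq hv] at hm
    obtain ⟨u, hvu, hu⟩ := h.maximal v hv hm
    exact ⟨u, hvu, (h.nextStatus_eq (N.alive_of_adj_right hvu)).trans hu⟩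

end Stabilized

section Untouched

variable {N N' : Network n Δ} {σ σ' : Fin n → Ram A} {x y : Fin n}

theorem touched_self_iff : Touched N σ N σ' x ↔ x ∈ N.alive ∧ σ x ≠ σ' x := by
  simp [Touched]

theorem alive_iff_of_not_touched (hx : ¬ Touched N σ N' σ' x) : x ∈ N.alive ↔ x ∈ N'.alive := by
  unfold Touched at hx
  tauto

theorem eq_of_not_touched (hx : ¬ Touched N σ N' σ' x) (hxN : x ∈ N.alive) : σ x = σ' x := by
  by_contra hne
  exact hx (.inr (.inr ⟨hxN, (alive_iff_of_not_touched hx).1 hxN, .inl hne⟩))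

theorem adj_iff_of_not_touched (hx : ¬ Touched N σ N' σ' x) (hy : ¬ Touched N σ N' σ' y) :
    N.graph.Adj x y ↔ N'.graph.Adj x y := by
  have hxa := alive_iff_of_not_touched hx
  have hya := alive_iff_of_not_touched hy
  by_contra hne
  have halive : x ∈ N.alive ∧ y ∈ N.alive := by
    by_cases hadj : N.graph.Adj x y
    · exact ⟨N.alive_of_adj hadj, N.alive_of_adj_right hadj⟩
    · have hadj' : N'.graph.Adj x y := by tauto
      exact ⟨hxa.2 (N'.alive_of_adj hadj'), hya.2 (N'.alive_of_adj_right hadj')⟩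
  exact hx (.inr (.inr ⟨halive.1, hxa.1 halive.1, .inr ⟨y, halive.2, hya.1 halive.2, hne⟩⟩))

end Untouched

/-- The vertex `u` is settled: it is present and in the MIS, and all its neighbors have status
`notMis`. This is the local part of stabilization, independent of the coloring, that fixes the
status of `u` and of its neighbors. -/
structure IsSettledMis (N : Network n Δ) (σ : Fin n → Ram A) (u : Fin n) : Prop where
  alive : u ∈ N.alive
  status_eq_mis : (σ u).status = .mis
  status_eq_notMis : ∀ x, N.graph.Adj u x → (σ x).status = .notMis

theorem Stabilized.isSettledMis {N : Network n Δ} {σ : Fin n → Ram A} {u : Fin n}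
    (h : Stabilized N σ) (huN : u ∈ N.alive) (hu : (σ u).status = .mis) : IsSettledMis N σ u where
  alive := huN
  status_eq_mis := hu
  status_eq_notMis x hux :=
    h.status_eq_notMis (N.alive_of_adj_right hux) fun hx => h.independent u x hux ⟨hu, hx⟩

theorem Stabilized.exists_isSettledMis {N : Network n Δ} {σ : Fin n → Ram A} {v : Fin n}
    (h : Stabilized N σ) (hv : v ∈ N.alive) :
    ∃ u, IsSettledMis N σ u ∧ N.graph.edist v u ≤ 1 := by
  simp only [SimpleGraph.edist_le_one_iff_adj_or_eq]
  by_cases hm : (σ v).status = .mis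
  · exact ⟨v, h.isSettledMis hv hm, .inr rfl⟩
  · obtain ⟨u, hvu, hu⟩ := h.maximal v hv hm
    exact ⟨u, h.isSettledMis (N.alive_of_adj_right hvu) hu, .inl hvu⟩

namespace IsSettledMis

variable {N N' : Network n Δ} {σ σ' : Fin n → Ram A} {u v : Fin n}

theorem status_eq_ite (h : IsSettledMis N σ u) (hvu : N.graph.edist v u ≤ 1) :
    (σ v).status = if v = u then .mis else .notMis := by
  split_ifs with hne
  · exact hne ▸ h.status_eq_mis
  · have hadj := (SimpleGraph.edist_le_one_iff_adj_or_eq.1 hvu).resolve_right hne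
    exact h.status_eq_notMis v hadj.symm

theorem misRound (h : IsSettledMis N σ u) : IsSettledMis N (misRound N σ) u where
  alive := h.alive
  status_eq_mis := by
    refine nextStatus_eq_mis_iff.2 ⟨?_, .inl h.status_eq_mis⟩
    rintro ⟨x, hux, hx⟩
    simp [h.status_eq_notMis x hux] at hx
  status_eq_notMis x hux := by
    refine nextStatus_eq_notMis_iff.2 ⟨?_, u, hux.symm, h.status_eq_mis⟩
    simp [h.status_eq_notMis x hux]

theorem of_not_touched (h : IsSettledMis N σ u) (hu : ¬ Touched N σ N' σ' u)
    (hnbr : ∀ x, N'.graph.Adj u x → ¬ Touched N σ N' σ' x) : IsSettledMis N' σ' u where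
  alive := (alive_iff_of_not_touched hu).1 h.alive
  status_eq_mis := by
    rw [← eq_of_not_touched hu h.alive]
    exact h.status_eq_mis
  status_eq_notMis x hux' := by
    have hux : N.graph.Adj u x := (adj_iff_of_not_touched hu (hnbr x hux')).2 hux'
    rw [← eq_of_not_touched (hnbr x hux') (N.alive_of_adj_right hux)]
    exact h.status_eq_notMis x hux

theorem of_two_lt_edist (h : IsSettledMis N σ u) (hvu : N.graph.edist v u ≤ 1)
    (hfar : ∀ x, Touched N σ N' σ' x → 2 < min (N.graph.edist v x) (N'.graph.edist v x)) :
    IsSettledMis N' σ' u ∧ N'.graph.edist v u ≤ 1 := by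
  have hv : ¬ Touched N σ N' σ' v := fun hx => by simpa using hfar v hx
  have hu : ¬ Touched N σ N' σ' u := fun hx =>
    absurd (hvu.trans one_le_two) (lt_min_iff.1 (hfar u hx)).1.not_ge
  have hvu' : N'.graph.edist v u ≤ 1 := by
    rwa [SimpleGraph.edist_le_one_iff_adj_or_eq, ← adj_iff_of_not_touched hv hu,
      ← SimpleGraph.edist_le_one_iff_adj_or_eq]
  refine ⟨h.of_not_touched hu fun x hux' hx => ?_, hvu'⟩
  have hvx : N'.graph.edist v x ≤ 2 := calc
    N'.graph.edist v x ≤ N'.graph.edist v u + N'.graph.edist u x := SimpleGraph.edist_triangle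
    _ ≤ 1 + 1 := add_le_add hvu' (SimpleGraph.edist_eq_one_iff_adj.2 hux').le
    _ = 2 := one_add_one_eq_two
  exact hvx.not_gt (lt_min_iff.1 (hfar x hx)).2

end IsSettledMis

namespace Execution

variable {E : Execution A} {s t : ℕ} {u v x : Fin n}

theorem distToFaults_antitone (E : Execution A) (v : Fin n) :
    Antitone fun t => E.distToFaults t v :=
  fun _ _ hst => biInf_mono fun _ hr => hr.trans_le hst

theorem distToFaults_le_of_touchedAt (hs : s < t) (hx : E.TouchedAt s x) :
    E.distToFaults t v ≤ min ((E.net s).graph.edist v x) ((E.net (s + 1)).graph.edist v x) :=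
  iInf₂_le_of_le s hs (iInf₂_le x hx)

theorem isSettledMis_of_two_lt_distToFaults (hu : IsSettledMis (E.net 0) (E.ram 0) u)
    (hvu : (E.net 0).graph.edist v u ≤ 1) (hfar : 2 < E.distToFaults t v) :
    IsSettledMis (E.net t) (E.ram t) u ∧ (E.net t).graph.edist v u ≤ 1 := by
  induction t with
  | zero => exact ⟨hu, hvu⟩
  | succ t ih =>
    obtain ⟨hut, hvut⟩ := ih (hfar.trans_le (E.distToFaults_antitone v t.le_succ))
    exact hut.misRound.of_two_lt_edist hvut fun x hx =>
      hfar.trans_le (distToFaults_le_of_touchedAt t.lt_succ_self hx)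

theorem status_eq_of_two_lt_distToFaults (h0 : Stabilized (E.net 0) (E.ram 0))
    (hv : v ∈ (E.net 0).alive) (hfar : 2 < E.distToFaults t v) :
    (E.ram t v).status = (E.ram 0 v).status := by
  obtain ⟨u, hu, hvu⟩ := h0.exists_isSettledMis hv
  obtain ⟨hut, hvut⟩ := isSettledMis_of_two_lt_distToFaults hu hvu hfar
  rw [hut.status_eq_ite hvut, hu.status_eq_ite hvu]

end Execution

theorem adjustmentRadius_le_two (A : ColoringAlgorithm n Δ) : adjustmentRadius A ≤ 2 := by
  refine sSup_le ?_
  rintro _ ⟨E, t, v, h0, hv, hne, rfl⟩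
  by_contra! hfar
  exact hne (E.status_eq_of_two_lt_distToFaults h0 hv hfar)

/-- The memory contents after a fault that overwrites the status of `w`, and nothing else, by
`mis`. -/
def forceMis (σ : Fin n → Ram A) (w : Fin n) : Fin n → Ram A :=
  Function.update σ w ⟨(σ w).mem, .mis⟩

section ForceMis

variable {N : Network n Δ} {σ : Fin n → Ram A} {u v w x : Fin n}

theorem forceMis_of_ne (hx : x ≠ w) : forceMis σ w x = σ x :=
  Function.update_of_ne hx _ σ

theorem status_forceMis_self : (forceMis σ w w).status = .mis := by
  simp [forceMis]

theorem mem_forceMis : (forceMis σ w x).mem = (σ x).mem := by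
  obtain rfl | hx := eq_or_ne x w
  · simp [forceMis]
  · rw [forceMis_of_ne hx]

theorem HasMisNeighbor.forceMis (h : HasMisNeighbor N σ x) :
    HasMisNeighbor N (forceMis σ w) x := by
  obtain ⟨y, hxy, hy⟩ := h
  refine ⟨y, hxy, ?_⟩
  obtain rfl | hne := eq_or_ne y w
  · exact status_forceMis_self
  · rwa [forceMis_of_ne hne]

namespace Stabilized

theorem hasMisNeighbor_forceMis (h : Stabilized N σ) (huw : N.graph.Adj u w)
    (hunique : ∀ x, N.graph.Adj v x → (σ x).status = .mis → x = u) (hvx : N.graph.Adj v x) :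
    HasMisNeighbor N (forceMis σ w) x := by
  by_cases hx : (σ x).status = .mis
  · obtain rfl := hunique x hvx hx
    exact ⟨w, huw, status_forceMis_self⟩
  · exact (h.maximal x (N.alive_of_adj_right hvx) hx).forceMis

theorem not_hasMisNeighbor_misRound_forceMis (h : Stabilized N σ) (huw : N.graph.Adj u w)
    (hunique : ∀ x, N.graph.Adj v x → (σ x).status = .mis → x = u) :
    ¬ HasMisNeighbor N (SelfStabMIS.misRound N (forceMis σ w)) v :=
  not_hasMisNeighbor_misRound fun _ hvx => h.hasMisNeighbor_forceMis huw hunique hvx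

theorem status_misRound_misRound_forceMis_ne_notMis (h : Stabilized N σ) (huw : N.graph.Adj u w)
    (hunique : ∀ x, N.graph.Adj v x → (σ x).status = .mis → x = u) :
    (SelfStabMIS.misRound N (SelfStabMIS.misRound N (forceMis σ w)) v).status ≠ .notMis :=
  fun hv => h.not_hasMisNeighbor_misRound_forceMis huw hunique (nextStatus_eq_notMis_iff.1 hv).2

theorem color_misRound_forceMis (h : Stabilized N σ) (hx : x ∈ N.alive) :
    A.color (SelfStabMIS.misRound N (forceMis σ w) x).mem = A.color (σ x).mem := by
  simp only [mem_misRound, mem_forceMis, h.color_round hx]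

theorem colorMinimal_misRound_forceMis (h : Stabilized N σ) (huw : N.graph.Adj u w)
    (hvw : ¬ N.graph.Adj v w)
    (hunique : ∀ x, N.graph.Adj v x → (σ x).status = .mis → x = u)
    (hcolor : A.color (σ v).mem < A.color (σ u).mem) :
    ColorMinimal N (SelfStabMIS.misRound N (forceMis σ w)) v := by
  intro x hvx hx
  have hxm : (σ x).status = .mis := by
    by_contra hne
    have hxw : x ≠ w := fun hxw => hvw (hxw ▸ hvx)
    have hnext : nextStatus N (forceMis σ w) x = .notMis :=
      nextStatus_eq_notMis_iff.2
        ⟨by rwa [forceMis_of_ne hxw], h.hasMisNeighbor_forceMis huw hunique hvx⟩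
    simp [hnext] at hx
  obtain rfl := hunique x hvx hxm
  rwa [h.color_misRound_forceMis (N.alive_of_adj hvx),
    h.color_misRound_forceMis (N.alive_of_adj_right hvx)]

theorem status_misRound_misRound_forceMis_eq_mis (h : Stabilized N σ) (huw : N.graph.Adj u w)
    (hvw : ¬ N.graph.Adj v w)
    (hunique : ∀ x, N.graph.Adj v x → (σ x).status = .mis → x = u)
    (hcolor : A.color (σ v).mem < A.color (σ u).mem) :
    (SelfStabMIS.misRound N (SelfStabMIS.misRound N (forceMis σ w)) v).status = .mis :=
  nextStatus_eq_mis_iff.2 ⟨h.not_hasMisNeighbor_misRound_forceMis huw hunique,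
    .inr (h.colorMinimal_misRound_forceMis huw hvw hunique hcolor)⟩

end Stabilized

end ForceMis

/-- The execution from `σ` in the static network `N` whose only fault puts `w` into the MIS. An
execution has no fault before round `0`, so the fault comes after a first undisturbed round. -/
noncomputable def singleFaultExecution (N : Network n Δ) (σ : Fin n → Ram A) (w : Fin n) :
    Execution A where
  net _ := N
  ram
    | 0 => σ
    | t + 1 => (misRound N)^[t] (forceMis (misRound N σ) w)

theorem eq_of_touchedAt_singleFaultExecution {N : Network n Δ} {σ : Fin n → Ram A} {w x : Fin n}
    {s : ℕ} (h : (singleFaultExecution N σ w).TouchedAt s x) : x = w := by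
  by_contra hne
  refine (touched_self_iff.1 h).2 ?_
  cases s with
  | zero => exact (forceMis_of_ne hne).symm
  | succ s => simp only [singleFaultExecution, Function.iterate_succ_apply']

theorem edist_le_distToFaults_singleFaultExecution (N : Network n Δ) (σ : Fin n → Ram A)
    (v w : Fin n) (t : ℕ) :
    N.graph.edist v w ≤ (singleFaultExecution N σ w).distToFaults t v := by
  refine le_iInf₂ fun s _ => le_iInf₂ fun x hx => ?_
  rw [eq_of_touchedAt_singleFaultExecution hx]
  exact (min_self _).ge

theorem Stabilized.edist_le_adjustmentRadius {N : Network n Δ} {σ : Fin n → Ram A}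
    {u v w : Fin n} (h : Stabilized N σ) (hvN : v ∈ N.alive) (hv : (σ v).status = .notMis)
    (huw : N.graph.Adj u w)
    (hunique : ∀ x, N.graph.Adj v x → (σ x).status = .mis → x = u) :
    N.graph.edist v w ≤ adjustmentRadius A := by
  refine (edist_le_distToFaults_singleFaultExecution N σ v w 3).trans
    (le_sSup ⟨singleFaultExecution N σ w, 3, v, h, hvN, ?_, rfl⟩)
  change (SelfStabMIS.misRound N (SelfStabMIS.misRound N _) v).status ≠ (σ v).status
  rw [hv]
  refine h.misRound.status_misRound_misRound_forceMis_ne_notMis huw fun x hvx hx => ?_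
  rw [status_misRound, h.nextStatus_eq (N.alive_of_adj_right hvx)] at hx
  exact hunique x hvx hx

open Classical in
/-- The memory contents in which the coloring algorithm has memory `m` and the MIS is the set
`S`. -/
noncomputable def withMisSet (m : Fin n → A.Mem) (S : Set (Fin n)) : Fin n → Ram A :=
  fun v => ⟨m v, if v ∈ S then .mis else .notMis⟩

section WithMisSet

variable {N : Network n Δ} {m : Fin n → A.Mem} {S : Set (Fin n)} {v : Fin n}

theorem status_withMisSet_eq_mis_iff : (withMisSet m S v).status = .mis ↔ v ∈ S := by
  simp [withMisSet]

theorem status_withMisSet_eq_notMis_iff : (withMisSet m S v).status = .notMis ↔ v ∉ S := by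
  simp [withMisSet]

theorem stabilized_withMisSet (hm : A.ColoringStable N m) (hindep : N.graph.IsIndepSet S)
    (hdom : ∀ v ∈ N.alive, v ∉ S → ∃ u ∈ S, N.graph.Adj v u) :
    Stabilized N (withMisSet m S) where
  coloring := hm
  decided v _ := by
    by_cases hv : v ∈ S <;> simp [withMisSet, hv]
  independent u v huv := by
    rw [status_withMisSet_eq_mis_iff, status_withMisSet_eq_mis_iff]
    exact fun ⟨hu, hv⟩ => hindep hu hv huv.ne huv
  maximal v hvN hv := by
    rw [Ne, status_withMisSet_eq_mis_iff] at hv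
    obtain ⟨u, hu, hvu⟩ := hdom v hvN hv
    exact ⟨u, hvu, status_withMisSet_eq_mis_iff.2 hu⟩

end WithMisSet

/-- The star with center `c` and set of leaves `L`, and with no other vertices present. -/
def starNetwork (c : Fin n) (L : Set (Fin n)) (hL : L.ncard ≤ Δ) : Network n Δ where
  alive := insert c L
  graph := (⊤ : SimpleGraph (Fin n)).between {c} L
  alive_of_adj := by
    rintro u v ⟨-, ⟨hu, -⟩ | ⟨hu, -⟩⟩
    exacts [.inl hu, .inr hu]
  degree_le v := by
    refine le_trans ?_ hL
    by_cases hv : v ∈ L ∧ v ≠ c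
    · have hsub : ((⊤ : SimpleGraph (Fin n)).between {c} L).neighborSet v ⊆ {c} := by
        rintro x ⟨-, ⟨hvc, -⟩ | ⟨-, hx⟩⟩
        exacts [absurd hvc hv.2, hx]
      exact calc
        _ ≤ ({c} : Set (Fin n)).ncard := Set.ncard_le_ncard hsub
        _ = 1 := Set.ncard_singleton c
        _ ≤ L.ncard := (Set.ncard_pos L.toFinite).2 ⟨v, hv.1⟩
    · refine Set.ncard_le_ncard ?_
      rintro x ⟨hne, ⟨-, hx⟩ | ⟨hvL, rfl⟩⟩
      exacts [hx, absurd ⟨hvL, hne⟩ hv]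

section StarNetwork

variable {c x y : Fin n} {L : Set (Fin n)} {hL : L.ncard ≤ Δ}

theorem starNetwork_adj :
    (starNetwork c L hL).graph.Adj x y ↔ x ≠ y ∧ (x = c ∧ y ∈ L ∨ x ∈ L ∧ y = c) := Iff.rfl

theorem stabilized_starNetwork {m : Fin n → A.Mem} (hm : A.ColoringStable (starNetwork c L hL) m) :
    Stabilized (starNetwork c L hL) (withMisSet m {c}) := by
  refine stabilized_withMisSet hm (Set.pairwise_singleton c _) fun x hx hxc => ⟨c, rfl, ?_⟩
  exact starNetwork_adj.2 ⟨hxc, .inr ⟨hx.resolve_left hxc, rfl⟩⟩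

theorem two_le_edist_starNetwork (hxy : x ≠ y) (hxc : x ≠ c) (hyc : y ≠ c) :
    2 ≤ (starNetwork c L hL).graph.edist x y := by
  rw [← one_add_one_eq_two]
  refine Order.add_one_le_of_lt (not_le.1 ?_)
  rw [SimpleGraph.edist_le_one_iff_adj_or_eq, starNetwork_adj]
  tauto

end StarNetwork

theorem two_le_adjustmentRadius (hn : 3 ≤ n) (hΔ : 2 ≤ Δ)
    (hA : ∀ N : Network n Δ, ∃ m, A.ColoringStable N m) : 2 ≤ adjustmentRadius A := by
  obtain ⟨v, u, w, hvu, hvw, huw⟩ :=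
    Fintype.two_lt_card_iff.1 (hn.trans_eq (Fintype.card_fin n).symm)
  have hL : ({v, w} : Set (Fin n)).ncard ≤ Δ := (Set.ncard_pair hvw).trans_le hΔ
  obtain ⟨m, hm⟩ := hA (starNetwork u {v, w} hL)
  calc
    2 ≤ (starNetwork u {v, w} hL).graph.edist v w := two_le_edist_starNetwork hvw hvu huw.symm
    _ ≤ adjustmentRadius A :=
      (stabilized_starNetwork hm).edist_le_adjustmentRadius (.inr (.inl rfl))
        (status_withMisSet_eq_notMis_iff.2 hvu)
        (starNetwork_adj.2 ⟨huw, .inl ⟨rfl, .inr rfl⟩⟩)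
        fun _ _ hx => Set.mem_singleton_iff.1 (status_withMisSet_eq_mis_iff.1 hx)

end SelfStabMIS

open SelfStabMIS in
theorem mainTheorem9_general {n Δ : ℕ} (A : ColoringAlgorithm n Δ) :
    adjustmentRadius A ≤ 2 ∧
    (3 ≤ n → 2 ≤ Δ → (∀ N : Network n Δ, ∃ m, A.ColoringStable N m) → adjustmentRadius A = 2) ∧
    (∀ (N : Network n Δ) (σ : Fin n → Ram A) (u v w : Fin n),
      Stabilized N σ → N.graph.Adj u w → ¬ N.graph.Adj v w →
      (∀ x, N.graph.Adj v x → (σ x).status = Status.mis → x = u) →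
      A.color (σ v).mem < A.color (σ u).mem →
      ((misRound N)^[2] (forceMis σ w) v).status = Status.mis) :=
  ⟨adjustmentRadius_le_two A,
    fun hn hΔ hA => (adjustmentRadius_le_two A).antisymm (two_le_adjustmentRadius hn hΔ hA),
    fun _ _ _ _ _ h => h.status_misRound_misRound_forceMis_eq_mis⟩

open SelfStabMIS in
theorem mainTheorem9 {n Δ : ℕ} (A : ColoringAlgorithm n Δ) :
    -- the upper bound
    adjustmentRadius A ≤ 2 ∧
    -- the exact value
    (3 ≤ n → 2 ≤ Δ → (∃ k : ℕ, A.IsSelfStabilizing k) → adjustmentRadius A = 2) ∧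
    -- a fault at distance two can make a vertex join the MIS
    (∀ (N : Network n Δ) (σ : Fin n → Ram A) (u v w : Fin n),
      Stabilized N σ → N.graph.Adj v u → N.graph.Adj u w → v ≠ w → ¬ N.graph.Adj v w →
      (σ v).status = Status.notMis →
      (∀ x, N.graph.Adj v x → ((σ x).status = Status.mis ↔ x = u)) →
      A.color (σ v).mem < A.color (σ u).mem →
      ((misRound N)^[2] (Function.update σ w ⟨(σ w).mem, Status.mis⟩) v).status = Status.mis) := by
  obtain ⟨hle, heq, hjoin⟩ := mainTheorem9_general A
  exact ⟨hle, fun hn hΔ ⟨_, hA⟩ => heq hn hΔ hA.exists_coloringStable,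
    fun N σ u v w h _ huw _ hvw _ hu => hjoin N σ u v w h huw hvw fun x hvx => (hu x hvx).1⟩
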